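/- Let $T>0$. All processes are defined on a probability space $(\Omega,\mathcal F,\mathbf P)$, are indexed by $[0,T]$ and have almost surely continuous paths. A fractional Brownian motion (fBm) with Hurst index $H\in(0,1)$ is a centered Gaussian process $B=(B_t)_{t\in[0,T]}$ with $B_0=0$ and $\mathbf{Cov}[B_t,B_s]=\tfrac12\left(t^{2H}+s^{2H}-|t-s|^{2H}\right)$; for $H=1/2$ it is the standard Brownian motion (Bm). Let $s_0,\sigma,\nu>0$, $\mu\in\mathbb R$. Let $W$ be a Bm and $B$ an fBm with Hurst index $H\in(0,1)$, $H\neq 1/2$. The price process $S=(S_t)_{t\in[0,T]}$ is - in the BS model: $S_t=s_0e^{\mu t+\sigma W_t-\frac12\sigma^2t}$; - in the fBS model: $S_t=s_0e^{\mu t+\nu B_t}$; - in the mfBS model: $S_t=s_0e^{\mu t+\sigma W_t-\frac12\sigma^2t+\nu B_t}$, where $W$ and $B$ are independent. For $t\in[0,T]$ and $n\in\mathbb N$ put $$V^n_t(S)=\sum_{\substack{0\le i\le 2^n-1\\ Ti/2^n\le t}}\left(S_{T(i+1)/2^n}-S_{Ti/2^n}\right)^2 ,$$ and call $\langle S\rangle_t=\lim_{n\to\infty}V^n_t(S)$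 the pathwise quadratic variation of $S$ along dyadic partitions, if almost surely the limit exists for all $t\in[0,T]$. Then: 1. In the fBS model and in the mfBS model with $H<1/2$, almost surely $V^n_t(S)\to+\infty$ as $n\to\infty$ for all $t\in(0,T]$. 2. In the fBS model with $H>1/2$, the quadratic variation exists and, almost surely, $\langle S\rangle_t=0$ for all $t\in[0,T]$. 3. In the BS model and in the mfBS model with $H>1/2$, the quadratic variation exists and satisfies $d\langle S\rangle_t=\sigma^2S_t^2\,dt$, that is, almost surely, $\langle S\rangle_t=\int_0^t\sigma^2S_u^2\,du$ for all $t\in[0,T]$. -/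

import Mathlib

open MeasureTheory ProbabilityTheory Filter Topology

noncomputable section

namespace FractionalPricing

variable {Ω : Type*} [MeasurableSpace Ω]

/-- Processes on `[0, T]` are written as functions `ℝ → Ω → ℝ`; only their values at times in
`[0, T]` matter.  `IsFBM P T H B`: the process `B` is, on `[0, T]`, a fractional Brownian motion
with Hurst index `H ∈ (0, 1)` under `P`, with almost surely continuous paths. -/
structure IsFBM (P : Measure Ω) (T H : ℝ) (B : ℝ → Ω → ℝ) : Prop where
  hurst_pos : 0 < H
  hurst_lt_one : H < 1
  gaussian : IsGaussianProcess (fun t : Set.Icc (0 : ℝ) T => B t) P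
  centered : ∀ t ∈ Set.Icc (0 : ℝ) T, ∫ ω, B t ω ∂P = 0
  start : ∀ᵐ ω ∂P, B 0 ω = 0
  covariance_eq : ∀ s ∈ Set.Icc (0 : ℝ) T, ∀ t ∈ Set.Icc (0 : ℝ) T,
    covariance (B t) (B s) P = 1 / 2 * (t ^ (2 * H) + s ^ (2 * H) - |t - s| ^ (2 * H))
  continuous_paths : ∀ᵐ ω ∂P, ContinuousOn (fun t => B t ω) (Set.Icc 0 T)

/-- Standard Brownian motion on `[0, T]`: the case `H = 1/2`, where the covariance is
`min s t`. -/
def IsBM (P : Measure Ω) (T : ℝ) (W : ℝ → Ω → ℝ) : Prop :=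
  IsFBM P T (1 / 2) W

/-- The Black–Scholes model. -/
def IsBSModel (P : Measure Ω) (T s₀ μ σ : ℝ) (S : ℝ → Ω → ℝ) : Prop :=
  0 < s₀ ∧ 0 < σ ∧ ∃ W : ℝ → Ω → ℝ, IsBM P T W ∧
    ∀ᵐ ω ∂P, ∀ t ∈ Set.Icc (0 : ℝ) T,
      S t ω = s₀ * Real.exp (μ * t + σ * W t ω - 1 / 2 * σ ^ 2 * t)

/-- The fractional Black–Scholes model with Hurst index `H ≠ 1/2`. -/
def IsFBSModel (P : Measure Ω) (T H s₀ μ ν : ℝ) (S : ℝ → Ω → ℝ) : Prop :=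
  H ≠ 1 / 2 ∧ 0 < s₀ ∧ 0 < ν ∧ ∃ B : ℝ → Ω → ℝ, IsFBM P T H B ∧
    ∀ᵐ ω ∂P, ∀ t ∈ Set.Icc (0 : ℝ) T,
      S t ω = s₀ * Real.exp (μ * t + ν * B t ω)

/-- The mixed fractional Black–Scholes model with Hurst index `H ≠ 1/2`: the Brownian motion `W`
and the fractional Brownian motion `B` are independent as processes on `[0, T]`. -/
def IsMFBSModel (P : Measure Ω) (T H s₀ μ σ ν : ℝ) (S : ℝ → Ω → ℝ) : Prop :=
  H ≠ 1 / 2 ∧ 0 < s₀ ∧ 0 < σ ∧ 0 < ν ∧ ∃ W B : ℝ → Ω → ℝ, IsBM P T W ∧ IsFBM P T H B ∧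
    IndepFun (fun ω (t : Set.Icc (0 : ℝ) T) => W t ω) (fun ω (t : Set.Icc (0 : ℝ) T) => B t ω) P ∧
    ∀ᵐ ω ∂P, ∀ t ∈ Set.Icc (0 : ℝ) T,
      S t ω = s₀ * Real.exp (μ * t + σ * W t ω - 1 / 2 * σ ^ 2 * t + ν * B t ω)

open Classical in
/-- The sum of squared increments of the path `x` over the `n`-th dyadic partition of `[0, T]`,
taken over the partition points `T i / 2 ^ n ≤ t` with `0 ≤ i ≤ 2 ^ n - 1`. -/
def dyadicQVSum (T : ℝ) (x : ℝ → ℝ) (t : ℝ) (n : ℕ) : ℝ :=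
  ∑ i ∈ (Finset.range (2 ^ n)).filter (fun i : ℕ => T * (i : ℝ) / 2 ^ n ≤ t),
    (x (T * ((i : ℝ) + 1) / 2 ^ n) - x (T * (i : ℝ) / 2 ^ n)) ^ 2

/-- `A` is the pathwise quadratic variation of `X` on `[0, T]` along dyadic partitions: almost
surely, for every `t ∈ [0, T]`, the dyadic sums converge to `A t`. -/
def HasDyadicQV (P : Measure Ω) (T : ℝ) (X A : ℝ → Ω → ℝ) : Prop :=
  ∀ᵐ ω ∂P, ∀ t ∈ Set.Icc (0 : ℝ) T,
    Tendsto (fun n => dyadicQVSum T (fun s => X s ω) t n) atTop (𝓝 (A t ω))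

/-- The dyadic sums of squared increments of `X` diverge to `+∞`: almost surely, for every
`t ∈ (0, T]`.  At `t = 0` the sum is the single term `(X_{T / 2 ^ n} - X_0) ^ 2`, which tends to
`0` for a continuous path, so this time is left out. -/
def DyadicQVDiverges (P : Measure Ω) (T : ℝ) (X : ℝ → Ω → ℝ) : Prop :=
  ∀ᵐ ω ∂P, ∀ t ∈ Set.Ioc (0 : ℝ) T,
    Tendsto (fun n => dyadicQVSum T (fun s => X s ω) t n) atTop atTop

end FractionalPricing

end

open FractionalPricing

/-!
The increments of a fractional Brownian motion over dyadic intervals of length `δ` have variance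
`δ ^ (2 * H)`. For `H > 1 / 2` the mean of the sum of their squares is of order
`δ ^ (2 * H - 1)`, summable along the dyadic scales, so the sum vanishes almost surely. For
`H ≤ 1 / 2` Isserlis' formula turns the variance of the sum into a sum of squared correlations;
since the increments are negatively correlated and their correlations telescope, each row of that
sum is bounded, and Chebyshev's inequality with Borel–Cantelli shows that
`δ ^ (1 - 2 * H)` times the sum up to time `t` tends to `t`. Monotonicity in `t` makes this
simultaneous in `t`, and adding a path of zero (or of finite) quadratic variation does not change
convergence (or divergence).

The passage from the log-price to the price is pathwise: by the mean value theorem each increment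
of `f ∘ x` is that of `x` times an intermediate value of `f' ∘ x`, so for `H < 1 / 2` divergence is
inherited, and otherwise the sums for `f ∘ x` are Riemann–Stieltjes sums of `(f' ∘ x) ^ 2` against
the dyadic quadratic variation of `x`, which converges to a linear function.
-/

namespace FractionalPricing

section BorelCantelli

variable {Ω : Type*} [MeasurableSpace Ω] {P : Measure Ω}

theorem ae_tendsto_zero_of_summable_integral_norm {E : Type*} [NormedAddCommGroup E]
    {f : ℕ → Ω → E} (hf : ∀ n, Integrable (f n) P) (hsum : Summable fun n => ∫ ω, ‖f n ω‖ ∂P) :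
    ∀ᵐ ω ∂P, Tendsto (fun n => f n ω) atTop (𝓝 0) := by
  have hnorm : ∑' n, eLpNorm (f n) 1 P ≠ ⊤ := by
    simp only [eLpNorm_one_eq_lintegral_enorm, ← ofReal_norm,
      ← ofReal_integral_eq_lintegral_ofReal (hf _).norm (ae_of_all _ fun _ => norm_nonneg _)]
    exact hsum.tsum_ofReal_ne_top
  filter_upwards [summable_norm_of_tsum_eLpNorm_ne_top le_rfl
    (fun n => (hf n).aestronglyMeasurable) hnorm] with ω hω
  exact tendsto_zero_iff_norm_tendsto_zero.2 hω.tendsto_atTop_zero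

theorem ae_tendsto_sub_integral_of_summable_variance [IsFiniteMeasure P] {X : ℕ → Ω → ℝ}
    (hX : ∀ n, MemLp (X n) 2 P) (hsum : Summable fun n => Var[X n; P]) :
    ∀ᵐ ω ∂P, Tendsto (fun n => X n ω - ∫ ω', X n ω' ∂P) atTop (𝓝 0) := by
  have hsq : ∀ n, Integrable (fun ω => (X n ω - ∫ ω', X n ω' ∂P) ^ 2) P := fun n =>
    ((hX n).sub (memLp_const _)).integrable_sq
  have hae := ae_tendsto_zero_of_summable_integral_norm hsq <| by
    simpa only [norm_pow, Real.norm_eq_abs, sq_abs,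
      ← variance_eq_integral (hX _).aestronglyMeasurable.aemeasurable] using hsum
  filter_upwards [hae] with ω hω
  refine tendsto_zero_iff_norm_tendsto_zero.2 ?_
  simpa only [Real.sqrt_sq_eq_abs, Real.sqrt_zero, Real.norm_eq_abs] using hω.sqrt

end BorelCantelli

section GaussianMoments

open Polynomial in
theorem deriv_eval_mul_exp_sq_div_two (p : ℝ[X]) (w : ℝ) :
    deriv (fun t => p.eval t * Real.exp (w * t ^ 2 / 2)) =
      fun t => (derivative p + p * (C w * X)).eval t * Real.exp (w * t ^ 2 / 2) := by
  funext t
  have hexp : HasDerivAt (fun t : ℝ => Real.exp (w * t ^ 2 / 2))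
      (Real.exp (w * t ^ 2 / 2) * (w * t)) t :=
    ((((hasDerivAt_id t).pow 2).const_mul w).div_const 2).exp.congr_deriv (by simp; ring)
  rw [((p.hasDerivAt t).fun_mul hexp).deriv]
  simp only [eval_add, eval_mul, eval_C, eval_X]
  ring

open Polynomial in
theorem integral_pow_four_gaussianReal (v : NNReal) :
    ∫ x, x ^ 4 ∂(gaussianReal 0 v) = 3 * (v : ℝ) ^ 2 := by
  have hmgf : mgf id (gaussianReal 0 v) =
      fun t => (1 : ℝ[X]).eval t * Real.exp (v * t ^ 2 / 2) := by
    simp [mgf_id_gaussianReal]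
  have hmoment := iteratedDeriv_mgf_zero (X := id) (μ := gaussianReal 0 v)
    (by simp [integrableExpSet_id_gaussianReal]) 4
  simp only [Pi.pow_apply, id] at hmoment
  rw [← hmoment, hmgf, iteratedDeriv_eq_iterate]
  simp only [Function.iterate_succ, Function.iterate_zero, Function.comp_apply, id,
    deriv_eval_mul_exp_sq_div_two]
  simp
  ring

variable {Ω : Type*} [MeasurableSpace Ω] {P : Measure Ω} {X Y : Ω → ℝ}

theorem integrable_pow_four_of_hasGaussianLaw (hX : HasGaussianLaw X P) :
    Integrable (fun ω => X ω ^ 4) P := by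
  have h := (hX.memLp (p := 4) (by norm_num)).integrable_norm_pow (by norm_num)
  simpa only [Real.norm_eq_abs, Even.pow_abs (by decide : Even 4)] using h

theorem memLp_sq_of_hasGaussianLaw (hX : HasGaussianLaw X P) :
    MemLp (fun ω => X ω ^ 2) 2 P := by
  rw [memLp_two_iff_integrable_sq (hX.aemeasurable.pow_const 2).aestronglyMeasurable]
  simpa only [← pow_mul] using integrable_pow_four_of_hasGaussianLaw hX

theorem integral_pow_four_of_hasGaussianLaw (hX : HasGaussianLaw X P) (h0 : ∫ ω, X ω ∂P = 0) :
    ∫ ω, X ω ^ 4 ∂P = 3 * (∫ ω, X ω ^ 2 ∂P) ^ 2 := by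
  have hlaw := hX.map_eq_gaussianReal
  rw [h0, variance_of_integral_eq_zero hX.aemeasurable h0] at hlaw
  rw [← integral_map (f := fun x : ℝ => x ^ 4) hX.aemeasurable (by fun_prop), hlaw,
    integral_pow_four_gaussianReal, Real.coe_toNNReal _ (integral_nonneg fun ω => sq_nonneg _)]

theorem integral_sq_mul_sq_of_hasGaussianLaw (hXY : HasGaussianLaw (fun ω => (X ω, Y ω)) P)
    (hX0 : ∫ ω, X ω ∂P = 0) (hY0 : ∫ ω, Y ω ∂P = 0) :
    ∫ ω, X ω ^ 2 * Y ω ^ 2 ∂P =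
      (∫ ω, X ω ^ 2 ∂P) * (∫ ω, Y ω ^ 2 ∂P) + 2 * (∫ ω, X ω * Y ω ∂P) ^ 2 := by
  have hX := hXY.fst
  have hY := hXY.snd
  have hadd := hXY.fun_add
  have hsub := hXY.fun_sub
  have iX2 := hX.memLp_two.integrable_sq
  have iY2 := hY.memLp_two.integrable_sq
  have iXY : Integrable (fun ω => X ω * Y ω) P := hX.memLp_two.integrable_mul hY.memLp_two
  have add_sq : ∫ ω, (X ω + Y ω) ^ 2 ∂P =
      ∫ ω, X ω ^ 2 ∂P + 2 * ∫ ω, X ω * Y ω ∂P + ∫ ω, Y ω ^ 2 ∂P := by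
    rw [← integral_const_mul, ← integral_add iX2 (iXY.const_mul 2),
      ← integral_add (iX2.fun_add (iXY.const_mul 2)) iY2]
    congr with ω
    ring
  have sub_sq : ∫ ω, (X ω - Y ω) ^ 2 ∂P =
      ∫ ω, X ω ^ 2 ∂P - 2 * ∫ ω, X ω * Y ω ∂P + ∫ ω, Y ω ^ 2 ∂P := by
    have iX2XY : Integrable (fun ω => X ω ^ 2 - 2 * (X ω * Y ω)) P := iX2.sub (iXY.const_mul 2)
    rw [← integral_const_mul, ← integral_sub iX2 (iXY.const_mul 2), ← integral_add iX2XY iY2]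
    congr with ω
    ring
  have polarization : ∀ ω, X ω ^ 2 * Y ω ^ 2 = (1 / 12 : ℝ) *
      (((X ω + Y ω) ^ 4 + (X ω - Y ω) ^ 4) - 2 * (X ω ^ 4 + Y ω ^ 4)) := fun ω => by ring
  have i4 {Z : Ω → ℝ} (hZ : HasGaussianLaw Z P) := integrable_pow_four_of_hasGaussianLaw hZ
  simp only [polarization]
  rw [integral_const_mul, integral_sub ((i4 hadd).fun_add (i4 hsub))
      (((i4 hX).fun_add (i4 hY)).const_mul 2), integral_add (i4 hadd) (i4 hsub), integral_const_mul,
    integral_add (i4 hX) (i4 hY), integral_pow_four_of_hasGaussianLaw hX hX0,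
    integral_pow_four_of_hasGaussianLaw hY hY0, integral_pow_four_of_hasGaussianLaw hadd
      (by rw [integral_add hX.integrable hY.integrable, hX0, hY0, add_zero]),
    integral_pow_four_of_hasGaussianLaw hsub
      (by rw [integral_sub hX.integrable hY.integrable, hX0, hY0, sub_zero]), add_sq, sub_sq]
  ring

theorem covariance_sq_sq_of_hasGaussianLaw (hXY : HasGaussianLaw (fun ω => (X ω, Y ω)) P)
    (hX0 : ∫ ω, X ω ∂P = 0) (hY0 : ∫ ω, Y ω ∂P = 0) :
    cov[fun ω => X ω ^ 2, fun ω => Y ω ^ 2; P] = 2 * (∫ ω, X ω * Y ω ∂P) ^ 2 := by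
  have := hXY.isProbabilityMeasure
  rw [covariance_eq_sub (memLp_sq_of_hasGaussianLaw hXY.fst) (memLp_sq_of_hasGaussianLaw hXY.snd)]
  simp only [Pi.mul_apply]
  rw [integral_sq_mul_sq_of_hasGaussianLaw hXY hX0 hY0]
  ring

theorem variance_sum_sq_of_hasGaussianLaw [IsFiniteMeasure P] {ι : Type*} {s : Finset ι}
    {Z : ι → Ω → ℝ} (hZ : ∀ i ∈ s, ∀ j ∈ s, HasGaussianLaw (fun ω => (Z i ω, Z j ω)) P)
    (hZ0 : ∀ i ∈ s, ∫ ω, Z i ω ∂P = 0) :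
    Var[fun ω => ∑ i ∈ s, Z i ω ^ 2; P] =
      ∑ i ∈ s, ∑ j ∈ s, 2 * (∫ ω, Z i ω * Z j ω ∂P) ^ 2 := by
  rw [variance_fun_sum' fun i hi => memLp_sq_of_hasGaussianLaw (hZ i hi i hi).fst]
  exact Finset.sum_congr rfl fun i hi => Finset.sum_congr rfl fun j hj =>
    covariance_sq_sq_of_hasGaussianLaw (hZ i hi j hj) (hZ0 i hi) (hZ0 j hj)

end GaussianMoments

section IncrementCorrelation

/-- The correlation at lag `k` of the unit-time increments of a fractional Brownian motion with
Hurst index `α / 2`. -/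
noncomputable def incrementCorr (α k : ℝ) : ℝ :=
  (|k + 1| ^ α + |k - 1| ^ α - 2 * |k| ^ α) / 2

variable {α : ℝ}

theorem incrementCorr_zero (hα : 0 < α) : incrementCorr α 0 = 1 := by
  simp [incrementCorr, Real.zero_rpow hα.ne']

theorem incrementCorr_neg (α k : ℝ) : incrementCorr α (-k) = incrementCorr α k := by
  unfold incrementCorr
  rw [← abs_neg (-k + 1), ← abs_neg (-k - 1), abs_neg k]
  ring_nf

theorem incrementCorr_nonpos (hα : 0 ≤ α) (hα1 : α ≤ 1) {k : ℝ} (hk : 1 ≤ |k|) :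
    incrementCorr α k ≤ 0 := by
  wlog h : 0 ≤ k generalizing k
  · rw [← incrementCorr_neg]
    exact this (by rwa [abs_neg]) (by linarith)
  rw [abs_of_nonneg h] at hk
  have concavity : 1 / 2 * (k + 1) ^ α + 1 / 2 * (k - 1) ^ α ≤
      (1 / 2 * (k + 1) + 1 / 2 * (k - 1)) ^ α :=
    (Real.concaveOn_rpow hα hα1).2 (Set.mem_Ici.2 (by linarith)) (Set.mem_Ici.2 (by linarith))
      (by norm_num) (by norm_num) (by norm_num)
  rw [show (1 / 2 * (k + 1) + 1 / 2 * (k - 1) : ℝ) = k by ring] at concavity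
  rw [incrementCorr, abs_of_nonneg h, abs_of_nonneg (by linarith), abs_of_nonneg (by linarith)]
  linarith

theorem sum_range_incrementCorr (α x : ℝ) (N : ℕ) :
    ∑ j ∈ Finset.range N, incrementCorr α (x - j) =
      ((|x + 1| ^ α - |x| ^ α) - (|x - N + 1| ^ α - |x - N| ^ α)) / 2 := by
  have telescope := Finset.sum_range_sub' (fun j : ℕ => |x - j + 1| ^ α - |x - j| ^ α) N
  simp only [Nat.cast_zero, sub_zero] at telescope
  rw [← telescope, Finset.sum_div]
  refine Finset.sum_congr rfl fun j _ => ?_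
  rw [incrementCorr, Nat.cast_succ, show x - (j + 1) + 1 = x - j by ring,
    show x - (j + 1) = x - j - 1 by ring]
  ring

theorem sum_range_incrementCorr_nonneg (hα : 0 ≤ α) {i N : ℕ} (hi : i < N) :
    0 ≤ ∑ j ∈ Finset.range N, incrementCorr α ((i : ℝ) - j) := by
  have hiN : (i : ℝ) + 1 ≤ N := by exact_mod_cast hi
  have hleft : |(i : ℝ)| ^ α ≤ |(i : ℝ) + 1| ^ α := by
    rw [abs_of_nonneg (by positivity), abs_of_nonneg (by positivity)]
    gcongr
    linarith
  have hright : |(i : ℝ) - N + 1| ^ α ≤ |(i : ℝ) - N| ^ α := by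
    rw [abs_of_nonpos (by linarith), abs_of_nonpos (by linarith)]
    gcongr <;> linarith
  rw [sum_range_incrementCorr]
  linarith

theorem sum_range_abs_incrementCorr_le (hα : 0 < α) (hα1 : α ≤ 1) {i N : ℕ} (hi : i < N) :
    ∑ j ∈ Finset.range N, |incrementCorr α ((i : ℝ) - j)| ≤ 2 := by
  have habs : ∀ j : ℕ, |incrementCorr α ((i : ℝ) - j)| =
      (if j = i then 2 else 0) - incrementCorr α ((i : ℝ) - j) := by
    intro j
    split_ifs with hji
    · rw [hji, sub_self, incrementCorr_zero hα]
      norm_num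
    · have hlag : (1 : ℝ) ≤ |(i : ℝ) - j| := by
        exact_mod_cast Int.one_le_abs (by omega : (i : ℤ) - j ≠ 0)
      rw [abs_of_nonpos (incrementCorr_nonpos hα.le hα1 hlag), zero_sub]
  simp only [habs, Finset.sum_sub_distrib, Finset.sum_ite_eq', Finset.mem_range, hi, if_true]
  exact sub_le_self _ (sum_range_incrementCorr_nonneg hα.le hi)

theorem sum_sq_incrementCorr_le (hα : 0 < α) (hα1 : α ≤ 1) (i : ℕ) (s : Finset ℕ) :
    ∑ j ∈ s, incrementCorr α ((i : ℝ) - j) ^ 2 ≤ 4 := by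
  obtain ⟨N, hN⟩ := (insert i s).exists_nat_subset_range
  obtain ⟨hi, hs⟩ := Finset.insert_subset_iff.1 hN
  calc ∑ j ∈ s, incrementCorr α ((i : ℝ) - j) ^ 2
      ≤ ∑ j ∈ Finset.range N, |incrementCorr α ((i : ℝ) - j)| ^ 2 := by
        simp only [sq_abs]
        exact Finset.sum_le_sum_of_subset_of_nonneg hs fun _ _ _ => sq_nonneg _
    _ ≤ (∑ j ∈ Finset.range N, |incrementCorr α ((i : ℝ) - j)|) ^ 2 :=
        Finset.sum_sq_le_sq_sum_of_nonneg fun _ _ => abs_nonneg _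
    _ ≤ 2 ^ 2 := by
        gcongr
        exact sum_range_abs_incrementCorr_le hα hα1 (Finset.mem_range.1 hi)
    _ = 4 := by norm_num

end IncrementCorrelation

section DyadicSums

/-- The dyadic point `T i / 2 ^ n` of the interval `[0, T]`. -/
noncomputable def dyadicPoint (T : ℝ) (n i : ℕ) : ℝ := T * i / 2 ^ n

/-- The increment of the path `x` over the `i`-th interval of the `n`-th dyadic partition of
`[0, T]`. -/
noncomputable def dyadicIncrement (T : ℝ) (x : ℝ → ℝ) (n i : ℕ) : ℝ :=
  x (dyadicPoint T n (i + 1)) - x (dyadicPoint T n i)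

open Classical in
/-- The indices `i` of the summands of `dyadicQVSum T x t n`: the `i`-th interval of the `n`-th
dyadic partition of `[0, T]` starts at or before `t`. -/
noncomputable def dyadicIndices (T t : ℝ) (n : ℕ) : Finset ℕ :=
  (Finset.range (2 ^ n)).filter fun i => dyadicPoint T n i ≤ t

theorem dyadicQVSum_eq_sum (T : ℝ) (x : ℝ → ℝ) (t : ℝ) (n : ℕ) :
    dyadicQVSum T x t n = ∑ i ∈ dyadicIndices T t n, dyadicIncrement T x n i ^ 2 :=
  Finset.sum_congr rfl fun i _ => by simp only [dyadicIncrement, dyadicPoint, Nat.cast_succ]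

theorem dyadicQVSum_nonneg (T : ℝ) (x : ℝ → ℝ) (t : ℝ) (n : ℕ) : 0 ≤ dyadicQVSum T x t n :=
  Finset.sum_nonneg fun _ _ => sq_nonneg _

variable {T : ℝ} {n i : ℕ}

theorem mem_dyadicIndices {t : ℝ} :
    i ∈ dyadicIndices T t n ↔ i < 2 ^ n ∧ dyadicPoint T n i ≤ t := by
  rw [dyadicIndices, Finset.mem_filter, Finset.mem_range]

theorem dyadicIndices_subset {s t : ℝ} (hst : s ≤ t) (n : ℕ) :
    dyadicIndices T s n ⊆ dyadicIndices T t n := fun _ hi =>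
  mem_dyadicIndices.2 ((mem_dyadicIndices.1 hi).imp_right fun h => h.trans hst)

theorem dyadicQVSum_mono (T : ℝ) (x : ℝ → ℝ) (n : ℕ) : Monotone (dyadicQVSum T x · n) := by
  intro s t hst
  simp only [dyadicQVSum_eq_sum]
  exact Finset.sum_le_sum_of_subset_of_nonneg (dyadicIndices_subset hst n) fun _ _ _ => sq_nonneg _

theorem dyadicPoint_mem_Icc (hT : 0 ≤ T) (hi : i ≤ 2 ^ n) : dyadicPoint T n i ∈ Set.Icc 0 T := by
  have h : (i : ℝ) ≤ 2 ^ n := by exact_mod_cast hi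
  refine ⟨by unfold dyadicPoint; positivity, ?_⟩
  rw [dyadicPoint, div_le_iff₀ (by positivity)]
  gcongr

theorem dyadicPoint_mem_Icc_of_mem {t : ℝ} (hT : 0 ≤ T) (hi : i ∈ dyadicIndices T t n) :
    dyadicPoint T n i ∈ Set.Icc 0 T ∧ dyadicPoint T n (i + 1) ∈ Set.Icc 0 T :=
  have hin := (mem_dyadicIndices.1 hi).1
  ⟨dyadicPoint_mem_Icc hT hin.le, dyadicPoint_mem_Icc hT hin⟩

theorem Icc_dyadicPoint_subset (hT : 0 ≤ T) (hi : i < 2 ^ n) :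
    Set.Icc (dyadicPoint T n i) (dyadicPoint T n (i + 1)) ⊆ Set.Icc 0 T :=
  Set.Icc_subset_Icc (dyadicPoint_mem_Icc hT hi.le).1 (dyadicPoint_mem_Icc hT hi).2

theorem dyadicPoint_sub (T : ℝ) (n i j : ℕ) :
    dyadicPoint T n i - dyadicPoint T n j = T / 2 ^ n * ((i : ℝ) - j) := by
  unfold dyadicPoint
  ring

theorem dyadicPoint_succ_sub (T : ℝ) (n i : ℕ) :
    dyadicPoint T n (i + 1) - dyadicPoint T n i = T / 2 ^ n := by
  rw [dyadicPoint_sub, Nat.cast_succ, add_sub_cancel_left, mul_one]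

theorem tendsto_dyadic_mesh (T : ℝ) : Tendsto (fun n : ℕ => T / 2 ^ n) atTop (𝓝 0) :=
  tendsto_const_nhds.div_atTop (tendsto_pow_atTop_atTop_of_one_lt one_lt_two)

theorem tendsto_dyadic_mesh_rpow_atTop (hT : 0 < T) {p : ℝ} (hp : p < 0) :
    Tendsto (fun n : ℕ => (T / 2 ^ n) ^ p) atTop atTop :=
  (tendsto_rpow_neg_nhdsGT_zero hp).comp <| tendsto_nhdsWithin_iff.2
    ⟨tendsto_dyadic_mesh T, Eventually.of_forall fun n => Set.mem_Ioi.2 (by positivity)⟩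

theorem summable_dyadic_mesh_rpow (hT : 0 ≤ T) {p : ℝ} (hp : 0 < p) :
    Summable fun n : ℕ => (T / 2 ^ n) ^ p := by
  have hratio : ((2 : ℝ) ^ p)⁻¹ < 1 := inv_lt_one_of_one_lt₀ (Real.one_lt_rpow one_lt_two hp)
  refine ((summable_geometric_of_lt_one (by positivity) hratio).mul_left (T ^ p)).congr fun n => ?_
  rw [Real.div_rpow hT (by positivity), ← Real.rpow_pow_comm two_pos.le, inv_pow, div_eq_mul_inv]

theorem card_dyadicIndices_mul_mesh_le (hT : 0 ≤ T) (t : ℝ) (n : ℕ) :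
    (dyadicIndices T t n).card * (T / 2 ^ n) ≤ T := by
  have hcard : ((dyadicIndices T t n).card : ℝ) ≤ 2 ^ n := by
    exact_mod_cast (Finset.card_filter_le _ _).trans_eq (Finset.card_range _)
  calc (dyadicIndices T t n).card * (T / 2 ^ n) ≤ 2 ^ n * (T / 2 ^ n) := by gcongr
    _ = T := mul_div_cancel₀ _ (by positivity)

theorem card_dyadicIndices {t : ℝ} (hT : 0 < T) (ht : 0 ≤ t) (n : ℕ) :
    (dyadicIndices T t n).card = min (2 ^ n) (⌊t * 2 ^ n / T⌋₊ + 1) := by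
  rw [← Finset.card_range (min _ _)]
  congr 1
  ext i
  rw [mem_dyadicIndices, dyadicPoint, Finset.mem_range, lt_min_iff, Nat.lt_succ_iff,
    Nat.le_floor_iff (by positivity), le_div_iff₀ hT, div_le_iff₀ (by positivity), mul_comm T]

theorem tendsto_card_dyadicIndices_mul_mesh {t : ℝ} (hT : 0 < T) (ht : t ∈ Set.Icc 0 T) :
    Tendsto (fun n => (dyadicIndices T t n).card * (T / 2 ^ n)) atTop (𝓝 t) := by
  have upper : Tendsto (fun n : ℕ => t + T / 2 ^ n) atTop (𝓝 t) := by
    simpa using (tendsto_dyadic_mesh T).const_add t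
  refine tendsto_of_tendsto_of_tendsto_of_le_of_le tendsto_const_nhds upper
    (fun n => ?_) fun n => ?_
  · have hfloor := (Nat.lt_floor_add_one (t * 2 ^ n / T)).le
    rw [card_dyadicIndices hT ht.1, Nat.cast_min, min_mul_of_nonneg _ _ (by positivity), le_min_iff]
    push_cast
    refine ⟨ht.2.trans_eq (mul_div_cancel₀ _ (by positivity)).symm, ?_⟩
    calc t = t * 2 ^ n / T * (T / 2 ^ n) := by field_simp
      _ ≤ _ := by gcongr
  · have hfloor := Nat.floor_le (by have := ht.1; positivity : 0 ≤ t * 2 ^ n / T)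
    calc (dyadicIndices T t n).card * (T / 2 ^ n)
        ≤ ((⌊t * 2 ^ n / T⌋₊ + 1 : ℕ) : ℝ) * (T / 2 ^ n) := by
          rw [card_dyadicIndices hT ht.1]
          gcongr
          exact min_le_right _ _
      _ ≤ (t * 2 ^ n / T + 1) * (T / 2 ^ n) := by
          push_cast
          gcongr
      _ = t + T / 2 ^ n := by field_simp

end DyadicSums

section MonotoneLimits

variable {ι α β : Type*} {l : Filter ι}
  [LinearOrder α] [TopologicalSpace α] [OrderTopology α] [DenselyOrdered α]
  [LinearOrder β] [TopologicalSpace β] [OrderTopology β]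

theorem eventually_lt_of_monotone_of_tendsto_dense {f : ι → α → β} {g : α → β} {D : Set α}
    (hf : ∀ i, Monotone (f i)) (hg : Continuous g) (hD : Dense D) (hbot : ∀ x, IsBot x → x ∈ D)
    (hfg : ∀ x ∈ D, Tendsto (f · x) l (𝓝 (g x))) {x : α} {a : β} (ha : a < g x) :
    ∀ᶠ i in l, a < f i x := by
  obtain ⟨y, hyD, hyx, hay⟩ : ∃ y ∈ D, y ≤ x ∧ a < g y := by
    by_cases hx : IsBot x
    · exact ⟨x, hbot x hx, le_rfl, ha⟩
    · obtain ⟨z, hzx, hz⟩ := exists_Ioc_subset_of_mem_nhds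
        (hg.continuousAt.eventually (lt_mem_nhds ha)) (by simpa [IsBot] using hx)
      obtain ⟨y, hyD, hzy, hyx⟩ := hD.exists_between hzx
      exact ⟨y, hyD, hyx.le, hz ⟨hzy, hyx.le⟩⟩
  filter_upwards [(hfg y hyD).eventually (lt_mem_nhds hay)] with i hi
  exact hi.trans_le (hf i hyx)

theorem tendsto_of_monotone_of_tendsto_dense {f : ι → α → β} {g : α → β} {D : Set α}
    (hf : ∀ i, Monotone (f i)) (hg : Continuous g) (hD : Dense D) (hbot : ∀ x, IsBot x → x ∈ D)
    (htop : ∀ x, IsTop x → x ∈ D) (hfg : ∀ x ∈ D, Tendsto (f · x) l (𝓝 (g x))) (x : α) :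
    Tendsto (f · x) l (𝓝 (g x)) :=
  tendsto_order.2
    ⟨fun _ ha => eventually_lt_of_monotone_of_tendsto_dense hf hg hD hbot hfg ha,
      fun _ ha => eventually_lt_of_monotone_of_tendsto_dense (α := αᵒᵈ) (β := βᵒᵈ)
        (fun i => (hf i).dual) hg hD htop hfg ha⟩

theorem ae_forall_tendsto_of_monotone [TopologicalSpace.SeparableSpace α] {Ω : Type*}
    [MeasurableSpace Ω] {P : Measure Ω} {f : ι → Ω → α → β} {g : α → β}
    (hf : ∀ i ω, Monotone (f i ω)) (hg : Continuous g)
    (hfg : ∀ x, ∀ᵐ ω ∂P, Tendsto (f · ω x) l (𝓝 (g x))) :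
    ∀ᵐ ω ∂P, ∀ x, Tendsto (f · ω x) l (𝓝 (g x)) := by
  obtain ⟨D, hDc, hD, hbot, htop⟩ := exists_countable_dense_bot_top α
  filter_upwards [(ae_ball_iff hDc).2 fun x _ => hfg x] with ω hω
  exact tendsto_of_monotone_of_tendsto_dense (hf · ω) hg hD hbot htop hω

end MonotoneLimits

section FractionalBrownianIncrements

variable {Ω : Type*} [MeasurableSpace Ω] {P : Measure Ω} {T H : ℝ} {B : ℝ → Ω → ℝ}

theorem IsFBM.hasGaussianLaw_increments (hB : IsFBM P T H B) {a b c d : ℝ}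
    (ha : a ∈ Set.Icc 0 T) (hb : b ∈ Set.Icc 0 T) (hc : c ∈ Set.Icc 0 T) (hd : d ∈ Set.Icc 0 T) :
    HasGaussianLaw (fun ω => (B b ω - B a ω, B d ω - B c ω)) P := by
  have hincrements : IsGaussianProcess
      (fun (p : Set.Icc (0 : ℝ) T × Set.Icc (0 : ℝ) T) ω => B p.2 ω - B p.1 ω) P := by
    classical
    exact hB.gaussian.of_isGaussianProcess fun p => ⟨{p.1, p.2},
      { toFun x := x ⟨p.2, by simp⟩ - x ⟨p.1, by simp⟩
        map_add' x y := by simp; abel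
        map_smul' c x := by simp; ring }, by simp⟩
  exact hincrements.hasGaussianLaw_prodMk (s := (⟨a, ha⟩, ⟨b, hb⟩)) (t := (⟨c, hc⟩, ⟨d, hd⟩))

theorem IsFBM.integral_increment (hB : IsFBM P T H B) {a b : ℝ} (ha : a ∈ Set.Icc 0 T)
    (hb : b ∈ Set.Icc 0 T) : ∫ ω, (B b ω - B a ω) ∂P = 0 := by
  rw [integral_sub (hB.gaussian.hasGaussianLaw_eval ⟨b, hb⟩).integrable
    (hB.gaussian.hasGaussianLaw_eval ⟨a, ha⟩).integrable, hB.centered _ ha, hB.centered _ hb,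
    sub_zero]

theorem IsFBM.integral_increment_mul_increment (hB : IsFBM P T H B) {a b c d : ℝ}
    (ha : a ∈ Set.Icc 0 T) (hb : b ∈ Set.Icc 0 T) (hc : c ∈ Set.Icc 0 T) (hd : d ∈ Set.Icc 0 T) :
    ∫ ω, (B b ω - B a ω) * (B d ω - B c ω) ∂P =
      (|b - c| ^ (2 * H) + |a - d| ^ (2 * H) - |b - d| ^ (2 * H) - |a - c| ^ (2 * H)) / 2 := by
  have := hB.gaussian.isProbabilityMeasure
  have hL2 {t : ℝ} (ht : t ∈ Set.Icc 0 T) : MemLp (B t) 2 P :=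
    (hB.gaussian.hasGaussianLaw_eval ⟨t, ht⟩).memLp_two
  have hcov := covariance_fun_sub_fun_sub (hL2 hb) (hL2 ha) (hL2 hd) (hL2 hc)
  rw [hB.covariance_eq _ hd _ hb, hB.covariance_eq _ hc _ hb, hB.covariance_eq _ hd _ ha,
    hB.covariance_eq _ hc _ ha, covariance, hB.integral_increment ha hb,
    hB.integral_increment hc hd] at hcov
  simp only [sub_zero] at hcov
  rw [hcov]
  ring

theorem IsFBM.integral_dyadicIncrement_mul_dyadicIncrement (hB : IsFBM P T H B) (hT : 0 ≤ T)
    {i j n : ℕ} (hi : i < 2 ^ n) (hj : j < 2 ^ n) :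
    ∫ ω, dyadicIncrement T (B · ω) n i * dyadicIncrement T (B · ω) n j ∂P =
      (T / 2 ^ n) ^ (2 * H) * incrementCorr (2 * H) ((i : ℝ) - j) := by
  have scaling (k l : ℕ) : |dyadicPoint T n k - dyadicPoint T n l| ^ (2 * H) =
      (T / 2 ^ n) ^ (2 * H) * |(k : ℝ) - l| ^ (2 * H) := by
    have hδ : 0 ≤ T / 2 ^ n := by positivity
    rw [dyadicPoint_sub, abs_mul, abs_of_nonneg hδ, Real.mul_rpow hδ (abs_nonneg _)]
  simp only [dyadicIncrement]
  rw [hB.integral_increment_mul_increment (dyadicPoint_mem_Icc hT hi.le) (dyadicPoint_mem_Icc hT hi)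
    (dyadicPoint_mem_Icc hT hj.le) (dyadicPoint_mem_Icc hT hj), scaling, scaling, scaling, scaling,
    incrementCorr]
  push_cast
  rw [show (i : ℝ) + 1 - j = i - j + 1 by ring, show (i : ℝ) - (j + 1) = i - j - 1 by ring,
    show (i : ℝ) + 1 - (j + 1) = i - j by ring]
  ring

theorem IsFBM.integral_dyadicIncrement_sq (hB : IsFBM P T H B) (hT : 0 ≤ T) {i n : ℕ}
    (hi : i < 2 ^ n) : ∫ ω, dyadicIncrement T (B · ω) n i ^ 2 ∂P = (T / 2 ^ n) ^ (2 * H) := by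
  have hself := hB.integral_dyadicIncrement_mul_dyadicIncrement hT hi hi
  rw [sub_self, incrementCorr_zero (by linarith [hB.hurst_pos]), mul_one] at hself
  simpa only [sq] using hself

theorem IsFBM.hasGaussianLaw_dyadicIncrements (hB : IsFBM P T H B) (hT : 0 ≤ T) {t : ℝ}
    {i j n : ℕ} (hi : i ∈ dyadicIndices T t n) (hj : j ∈ dyadicIndices T t n) :
    HasGaussianLaw
      (fun ω => (dyadicIncrement T (B · ω) n i, dyadicIncrement T (B · ω) n j)) P :=
  have ⟨hi₀, hi₁⟩ := dyadicPoint_mem_Icc_of_mem hT hi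
  have ⟨hj₀, hj₁⟩ := dyadicPoint_mem_Icc_of_mem hT hj
  hB.hasGaussianLaw_increments hi₀ hi₁ hj₀ hj₁

theorem IsFBM.memLp_dyadicQVSum (hB : IsFBM P T H B) (hT : 0 ≤ T) (t : ℝ) (n : ℕ) :
    MemLp (fun ω => dyadicQVSum T (B · ω) t n) 2 P := by
  simp only [dyadicQVSum_eq_sum]
  exact memLp_finsetSum _ fun i hi =>
    memLp_sq_of_hasGaussianLaw (hB.hasGaussianLaw_dyadicIncrements hT hi hi).fst

theorem IsFBM.integral_dyadicQVSum (hB : IsFBM P T H B) (hT : 0 ≤ T) (t : ℝ) (n : ℕ) :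
    ∫ ω, dyadicQVSum T (B · ω) t n ∂P = (dyadicIndices T t n).card * (T / 2 ^ n) ^ (2 * H) := by
  simp only [dyadicQVSum_eq_sum]
  rw [integral_finsetSum _ fun i hi =>
      (hB.hasGaussianLaw_dyadicIncrements hT hi hi).fst.memLp_two.integrable_sq,
    Finset.sum_congr rfl fun i hi => hB.integral_dyadicIncrement_sq hT (mem_dyadicIndices.1 hi).1,
    Finset.sum_const, nsmul_eq_mul]

theorem IsFBM.variance_dyadicQVSum_le (hB : IsFBM P T H B) (hH : H ≤ 1 / 2) (hT : 0 ≤ T) (t : ℝ)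
    (n : ℕ) : Var[fun ω => dyadicQVSum T (B · ω) t n; P] ≤
      8 * (dyadicIndices T t n).card * ((T / 2 ^ n) ^ (2 * H)) ^ 2 := by
  have := hB.gaussian.isProbabilityMeasure
  simp only [dyadicQVSum_eq_sum]
  rw [variance_sum_sq_of_hasGaussianLaw
    (fun i hi j hj => hB.hasGaussianLaw_dyadicIncrements hT hi hj)
    fun i hi => hB.integral_increment (dyadicPoint_mem_Icc_of_mem hT hi).1
      (dyadicPoint_mem_Icc_of_mem hT hi).2]
  calc ∑ i ∈ dyadicIndices T t n, ∑ j ∈ dyadicIndices T t n,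
        2 * (∫ ω, dyadicIncrement T (B · ω) n i * dyadicIncrement T (B · ω) n j ∂P) ^ 2
      = ∑ i ∈ dyadicIndices T t n, 2 * ((T / 2 ^ n) ^ (2 * H)) ^ 2 *
          ∑ j ∈ dyadicIndices T t n, incrementCorr (2 * H) ((i : ℝ) - j) ^ 2 := by
        refine Finset.sum_congr rfl fun i hi => ?_
        rw [Finset.mul_sum]
        refine Finset.sum_congr rfl fun j hj => ?_
        rw [hB.integral_dyadicIncrement_mul_dyadicIncrement hT (mem_dyadicIndices.1 hi).1
          (mem_dyadicIndices.1 hj).1]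
        ring
    _ ≤ ∑ i ∈ dyadicIndices T t n, 2 * ((T / 2 ^ n) ^ (2 * H)) ^ 2 * 4 := by
        gcongr with i
        exact sum_sq_incrementCorr_le (by linarith [hB.hurst_pos]) (by linarith) i _
    _ = 8 * (dyadicIndices T t n).card * ((T / 2 ^ n) ^ (2 * H)) ^ 2 := by
        rw [Finset.sum_const, nsmul_eq_mul]
        ring

end FractionalBrownianIncrements

section FractionalBrownianQuadraticVariation

variable {Ω : Type*} [MeasurableSpace Ω] {P : Measure Ω} {T H : ℝ} {B : ℝ → Ω → ℝ}

theorem IsFBM.ae_tendsto_rescaled_dyadicQVSum (hB : IsFBM P T H B) (hH : H ≤ 1 / 2) (hT : 0 < T)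
    {t : ℝ} (ht : t ∈ Set.Icc 0 T) : ∀ᵐ ω ∂P,
      Tendsto (fun n => (T / 2 ^ n) ^ (1 - 2 * H) * dyadicQVSum T (B · ω) t n) atTop (𝓝 t) := by
  have := hB.gaussian.isProbabilityMeasure
  have hscale (n : ℕ) : (T / 2 ^ n) ^ (1 - 2 * H) * (T / 2 ^ n) ^ (2 * H) = T / 2 ^ n := by
    rw [← Real.rpow_add (by positivity), sub_add_cancel, Real.rpow_one]
  have hvar (n : ℕ) : Var[fun ω => (T / 2 ^ n) ^ (1 - 2 * H) * dyadicQVSum T (B · ω) t n; P] ≤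
      8 * T * (T / 2 ^ n) ^ (1 : ℝ) := by
    rw [variance_const_mul]
    calc _ ≤ ((T / 2 ^ n) ^ (1 - 2 * H)) ^ 2 *
          (8 * (dyadicIndices T t n).card * ((T / 2 ^ n) ^ (2 * H)) ^ 2) := by
          gcongr
          exact hB.variance_dyadicQVSum_le hH hT.le t n
      _ = 8 * (dyadicIndices T t n).card *
          ((T / 2 ^ n) ^ (1 - 2 * H) * (T / 2 ^ n) ^ (2 * H)) ^ 2 := by ring
      _ = 8 * ((dyadicIndices T t n).card * (T / 2 ^ n)) * (T / 2 ^ n) := by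
          rw [hscale]
          ring
      _ ≤ 8 * T * (T / 2 ^ n) ^ (1 : ℝ) := by
          rw [Real.rpow_one]
          gcongr
          exact card_dyadicIndices_mul_mesh_le hT.le t n
  have hconc := ae_tendsto_sub_integral_of_summable_variance
    (fun n => (hB.memLp_dyadicQVSum hT.le t n).const_mul ((T / 2 ^ n) ^ (1 - 2 * H)))
    (.of_nonneg_of_le (fun n => variance_nonneg _ _) hvar
      ((summable_dyadic_mesh_rpow hT.le one_pos).mul_left _))
  filter_upwards [hconc] with ω hω
  have hsum := hω.add (tendsto_card_dyadicIndices_mul_mesh hT ht)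
  rw [zero_add] at hsum
  refine hsum.congr fun n => ?_
  rw [integral_const_mul, hB.integral_dyadicQVSum hT.le, mul_left_comm, hscale, sub_add_cancel]

theorem IsFBM.ae_forall_tendsto_rescaled_dyadicQVSum (hB : IsFBM P T H B) (hH : H ≤ 1 / 2)
    (hT : 0 < T) : ∀ᵐ ω ∂P, ∀ t ∈ Set.Icc 0 T,
      Tendsto (fun n => (T / 2 ^ n) ^ (1 - 2 * H) * dyadicQVSum T (B · ω) t n) atTop (𝓝 t) := by
  have hsimultaneous := ae_forall_tendsto_of_monotone (α := Set.Icc 0 T) (P := P) (l := atTop)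
    (f := fun n ω t => (T / 2 ^ n) ^ (1 - 2 * H) * dyadicQVSum T (B · ω) t n) (g := (↑))
    (fun n ω s t hst => mul_le_mul_of_nonneg_left (dyadicQVSum_mono T _ n hst) (by positivity))
    continuous_subtype_val fun t => hB.ae_tendsto_rescaled_dyadicQVSum hH hT t.2
  filter_upwards [hsimultaneous] with ω hω t ht using hω ⟨t, ht⟩

theorem IsBM.ae_tendsto_dyadicQVSum {W : ℝ → Ω → ℝ} (hW : IsBM P T W) (hT : 0 < T) :
    ∀ᵐ ω ∂P, ∀ t ∈ Set.Icc 0 T, Tendsto (dyadicQVSum T (W · ω) t) atTop (𝓝 t) := by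
  filter_upwards [IsFBM.ae_forall_tendsto_rescaled_dyadicQVSum hW le_rfl hT] with ω hω t ht
  simpa using hω t ht

theorem IsFBM.ae_tendsto_dyadicQVSum_atTop (hB : IsFBM P T H B) (hH : H < 1 / 2) (hT : 0 < T) :
    ∀ᵐ ω ∂P, ∀ t ∈ Set.Ioc 0 T, Tendsto (dyadicQVSum T (B · ω) t) atTop atTop := by
  filter_upwards [hB.ae_forall_tendsto_rescaled_dyadicQVSum hH.le hT] with ω hω t ht
  have hmesh := tendsto_dyadic_mesh_rpow_atTop hT (by linarith : 2 * H - 1 < 0)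
  refine (hmesh.atTop_mul_pos ht.1 (hω t (Set.Ioc_subset_Icc_self ht))).congr fun n => ?_
  rw [← mul_assoc, ← Real.rpow_add (by positivity)]
  simp

theorem IsFBM.ae_tendsto_dyadicQVSum_zero (hB : IsFBM P T H B) (hH : 1 / 2 < H) (hT : 0 < T) :
    ∀ᵐ ω ∂P, ∀ t ∈ Set.Icc 0 T, Tendsto (dyadicQVSum T (B · ω) t) atTop (𝓝 0) := by
  have := hB.gaussian.isProbabilityMeasure
  have hmean (n : ℕ) : ∫ ω, ‖dyadicQVSum T (B · ω) T n‖ ∂P ≤ T * (T / 2 ^ n) ^ (2 * H - 1) := by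
    simp only [Real.norm_of_nonneg (dyadicQVSum_nonneg _ _ _ _)]
    rw [hB.integral_dyadicQVSum hT.le]
    calc (dyadicIndices T T n).card * (T / 2 ^ n) ^ (2 * H)
        = (dyadicIndices T T n).card * (T / 2 ^ n) * (T / 2 ^ n) ^ (2 * H - 1) := by
          rw [mul_assoc, ← Real.rpow_one_add' (by positivity) (by linarith), add_sub_cancel]
      _ ≤ T * (T / 2 ^ n) ^ (2 * H - 1) := by
          gcongr
          exact card_dyadicIndices_mul_mesh_le hT.le T n
  filter_upwards [ae_tendsto_zero_of_summable_integral_norm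
    (fun n => (hB.memLp_dyadicQVSum hT.le T n).integrable one_le_two)
    (.of_nonneg_of_le (fun n => integral_nonneg fun ω => norm_nonneg _) hmean
      ((summable_dyadic_mesh_rpow hT.le (by linarith)).mul_left _))] with ω hω t ht
  exact squeeze_zero (dyadicQVSum_nonneg T _ t) (fun n => dyadicQVSum_mono T _ n ht.2) hω

end FractionalBrownianQuadraticVariation

section PathwiseQuadraticVariation

variable {T t a : ℝ} {x z : ℝ → ℝ}

theorem dyadicQVSum_congr (hT : 0 ≤ T) (hxz : Set.EqOn x z (Set.Icc 0 T)) (t : ℝ) :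
    dyadicQVSum T x t = dyadicQVSum T z t := by
  ext n
  rw [dyadicQVSum_eq_sum, dyadicQVSum_eq_sum]
  refine Finset.sum_congr rfl fun i hi => ?_
  have ⟨hi₀, hi₁⟩ := dyadicPoint_mem_Icc_of_mem hT hi
  rw [dyadicIncrement, dyadicIncrement, hxz hi₀, hxz hi₁]

theorem dyadicQVSum_const_mul (T c : ℝ) (x : ℝ → ℝ) (t : ℝ) (n : ℕ) :
    dyadicQVSum T (fun s => c * x s) t n = c ^ 2 * dyadicQVSum T x t n := by
  simp only [dyadicQVSum_eq_sum, dyadicIncrement, Finset.mul_sum, ← mul_sub, mul_pow]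

theorem tendsto_dyadicQVSum_const_mul (hx : Tendsto (dyadicQVSum T x t) atTop (𝓝 a)) (c : ℝ) :
    Tendsto (dyadicQVSum T (fun s => c * x s) t) atTop (𝓝 (c ^ 2 * a)) :=
  (hx.const_mul (c ^ 2)).congr fun n => (dyadicQVSum_const_mul T c x t n).symm

theorem tendsto_dyadicQVSum_const_mul_atTop {c : ℝ} (hc : c ≠ 0)
    (hx : Tendsto (dyadicQVSum T x t) atTop atTop) :
    Tendsto (dyadicQVSum T (fun s => c * x s) t) atTop atTop :=
  (hx.const_mul_atTop (by positivity)).congr fun n => (dyadicQVSum_const_mul T c x t n).symm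

theorem tendsto_dyadicQVSum_linear (hT : 0 < T) (ht : t ∈ Set.Icc 0 T) (c : ℝ) :
    Tendsto (dyadicQVSum T (fun s => c * s) t) atTop (𝓝 0) := by
  have hlength := (tendsto_card_dyadicIndices_mul_mesh hT ht).mul (tendsto_dyadic_mesh T)
  rw [mul_zero] at hlength
  rw [← mul_zero (c ^ 2)]
  refine tendsto_dyadicQVSum_const_mul (hlength.congr fun n => ?_) c
  simp only [dyadicQVSum_eq_sum, dyadicIncrement, dyadicPoint_succ_sub, Finset.sum_const,
    nsmul_eq_mul]
  ring

theorem tendsto_dyadicQVSum_add (hx : Tendsto (dyadicQVSum T x t) atTop (𝓝 a))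
    (hz : Tendsto (dyadicQVSum T z t) atTop (𝓝 0)) :
    Tendsto (dyadicQVSum T (fun s => x s + z s) t) atTop (𝓝 a) := by
  let cross (n : ℕ) : ℝ :=
    ∑ i ∈ dyadicIndices T t n, dyadicIncrement T x n i * dyadicIncrement T z n i
  have hcauchySchwarz (n : ℕ) : cross n ^ 2 ≤ dyadicQVSum T x t n * dyadicQVSum T z t n := by
    simpa only [dyadicQVSum_eq_sum] using Finset.sum_mul_sq_le_sq_mul_sq _ _ _
  have hcross : Tendsto cross atTop (𝓝 0) := by
    have hsq : Tendsto (fun n => cross n ^ 2) atTop (𝓝 0) :=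
      squeeze_zero (fun n => sq_nonneg _) hcauchySchwarz (by simpa using hx.mul hz)
    rw [tendsto_zero_iff_abs_tendsto_zero]
    simpa [Real.sqrt_sq_eq_abs, Function.comp_def] using hsq.sqrt
  have hsum := (hx.add (hcross.const_mul 2)).add hz
  rw [mul_zero, add_zero, add_zero] at hsum
  refine hsum.congr fun n => ?_
  simp only [dyadicQVSum_eq_sum, cross, Finset.mul_sum, ← Finset.sum_add_distrib, dyadicIncrement]
  exact Finset.sum_congr rfl fun i _ => by ring

theorem tendsto_dyadicQVSum_add_atTop (hx : Tendsto (dyadicQVSum T x t) atTop (𝓝 a))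
    (hz : Tendsto (dyadicQVSum T z t) atTop atTop) :
    Tendsto (dyadicQVSum T (fun s => x s + z s) t) atTop atTop := by
  refine tendsto_atTop_mono (fun n => ?_)
    ((hz.const_mul_atTop (one_half_pos (α := ℝ))).atTop_add hx.neg)
  simp only [dyadicQVSum_eq_sum, Finset.mul_sum, ← Finset.sum_neg_distrib,
    ← Finset.sum_add_distrib]
  refine Finset.sum_le_sum fun i _ => ?_
  calc 1 / 2 * dyadicIncrement T z n i ^ 2 + -dyadicIncrement T x n i ^ 2
      ≤ (dyadicIncrement T x n i + dyadicIncrement T z n i) ^ 2 := by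
        linarith [sq_nonneg (2 * dyadicIncrement T x n i + dyadicIncrement T z n i)]
    _ = dyadicIncrement T (fun s => x s + z s) n i ^ 2 := by
        simp only [dyadicIncrement]
        ring

end PathwiseQuadraticVariation

section IntermediateValues

variable {T : ℝ} {x f f' : ℝ → ℝ}

theorem exists_mem_uIcc_sub_eq_deriv_mul (hf : ∀ z, HasDerivAt f (f' z) z) (p q : ℝ) :
    ∃ r ∈ Set.uIcc p q, f q - f p = f' r * (q - p) := by
  wlog hpq : p ≤ q generalizing p q
  · obtain ⟨r, hr, hslope⟩ := this q p (le_of_not_ge hpq)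
    exact ⟨r, Set.uIcc_comm q p ▸ hr, by linarith⟩
  obtain rfl | hlt := hpq.eq_or_lt
  · exact ⟨p, Set.left_mem_uIcc, by simp⟩
  · obtain ⟨r, hr, hslope⟩ := exists_hasDerivAt_eq_slope f f' hlt
      (fun z _ => (hf z).continuousAt.continuousWithinAt) fun z _ => hf z
    exact ⟨r, Set.Icc_subset_uIcc (Set.Ioo_subset_Icc_self hr),
      by rw [hslope, div_mul_cancel₀ _ (sub_pos.2 hlt).ne']⟩

theorem exists_mem_uIcc_comp_sub_eq_deriv_mul (hf : ∀ z, HasDerivAt f (f' z) z) {a b : ℝ}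
    (hx : ContinuousOn x (Set.uIcc a b)) :
    ∃ u ∈ Set.uIcc a b, f (x b) - f (x a) = f' (x u) * (x b - x a) := by
  obtain ⟨r, hr, hslope⟩ := exists_mem_uIcc_sub_eq_deriv_mul hf (x a) (x b)
  obtain ⟨u, hu, rfl⟩ := intermediate_value_uIcc hx hr
  exact ⟨u, hu, hslope⟩

theorem exists_dyadicIncrement_comp_eq_deriv_mul (hT : 0 ≤ T) (hf : ∀ z, HasDerivAt f (f' z) z)
    (hx : ContinuousOn x (Set.Icc 0 T)) {n i : ℕ} (hi : i < 2 ^ n) :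
    ∃ u ∈ Set.Icc (dyadicPoint T n i) (dyadicPoint T n (i + 1)),
      dyadicIncrement T (fun s => f (x s)) n i = f' (x u) * dyadicIncrement T x n i := by
  have hle : dyadicPoint T n i ≤ dyadicPoint T n (i + 1) := by
    have := dyadicPoint_succ_sub T n i
    linarith [(by positivity : 0 ≤ T / 2 ^ n)]
  rw [← Set.uIcc_of_le hle]
  refine exists_mem_uIcc_comp_sub_eq_deriv_mul hf (hx.mono ?_)
  rw [Set.uIcc_of_le hle]
  exact Icc_dyadicPoint_subset hT hi

theorem tendsto_dyadicQVSum_comp_atTop (hT : 0 ≤ T) (hf : ∀ z, HasDerivAt f (f' z) z)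
    (hf' : Continuous f') (hf'₀ : ∀ z, f' z ≠ 0) (hx : ContinuousOn x (Set.Icc 0 T)) {t : ℝ}
    (hV : Tendsto (dyadicQVSum T x t) atTop atTop) :
    Tendsto (dyadicQVSum T (fun s => f (x s)) t) atTop atTop := by
  obtain ⟨r, -, hr⟩ := isCompact_Icc.exists_isMinOn (Set.nonempty_Icc.2 hT)
    ((hf'.comp_continuousOn hx).pow 2)
  refine tendsto_atTop_mono (fun n => ?_)
    (hV.const_mul_atTop (by have := hf'₀ (x r); positivity : 0 < f' (x r) ^ 2))
  rw [dyadicQVSum_eq_sum, dyadicQVSum_eq_sum, Finset.mul_sum]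
  refine Finset.sum_le_sum fun i hi => ?_
  have hin := (mem_dyadicIndices.1 hi).1
  obtain ⟨u, hu, hincrement⟩ := exists_dyadicIncrement_comp_eq_deriv_mul hT hf hx hin
  rw [hincrement, mul_pow]
  exact mul_le_mul_of_nonneg_right (hr (Icc_dyadicPoint_subset hT hin hu)) (sq_nonneg _)

end IntermediateValues

section StieltjesSums

/-- Up to the error `ε * (F s' - F s)`, the function `G` increases by `φ s * (F s' - F s)` on every
interval `[s, s'] ⊆ [0, b]` of length at most `η`: a quantitative form of `dG = φ dF` that passes
to limits and covers sums and integrals alike. -/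
def HasStieltjesIncrements (φ F G : ℝ → ℝ) (b ε η : ℝ) : Prop :=
  ∀ ⦃s s'⦄, 0 ≤ s → s ≤ s' → s' ≤ b → s' - s ≤ η →
    |G s' - G s - φ s * (F s' - F s)| ≤ ε * (F s' - F s)

variable {φ F G : ℝ → ℝ} {b c t T ε η : ℝ}

theorem sum_range_dyadicIncrement (t : ℝ) (x : ℝ → ℝ) (m : ℕ) :
    ∑ k ∈ Finset.range (2 ^ m), dyadicIncrement t x m k = x t - x 0 := by
  simp only [dyadicIncrement]
  rw [Finset.sum_range_sub fun k => x (dyadicPoint t m k)]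
  simp [dyadicPoint]

/-- The left-point Riemann–Stieltjes sum of `φ` against `F` over the `m`-th dyadic partition of
`[0, t]`. -/
noncomputable def dyadicStieltjesSum (φ F : ℝ → ℝ) (t : ℝ) (m : ℕ) : ℝ :=
  ∑ k ∈ Finset.range (2 ^ m), φ (dyadicPoint t m k) * dyadicIncrement t F m k

theorem HasStieltjesIncrements.abs_sub_dyadicStieltjesSum_le
    (h : HasStieltjesIncrements φ F G b ε η) (ht : t ∈ Set.Icc 0 b) {m : ℕ} (hm : t / 2 ^ m ≤ η) :
    |G t - G 0 - dyadicStieltjesSum φ F t m| ≤ ε * (F t - F 0) := by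
  rw [← sum_range_dyadicIncrement t G m, ← sum_range_dyadicIncrement t F m, dyadicStieltjesSum,
    ← Finset.sum_sub_distrib, Finset.mul_sum]
  refine (Finset.abs_sum_le_sum_abs _ _).trans (Finset.sum_le_sum fun k hk => ?_)
  have hk := Finset.mem_range.1 hk
  have hlength := dyadicPoint_succ_sub t m k
  have hmesh : 0 ≤ t / 2 ^ m := div_nonneg ht.1 (by positivity)
  exact h (dyadicPoint_mem_Icc ht.1 hk.le).1 (by linarith)
    ((dyadicPoint_mem_Icc ht.1 hk).2.trans ht.2) (by linarith)

theorem HasStieltjesIncrements.abs_sub_le {F₀ G₀ : ℝ → ℝ}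
    (h : HasStieltjesIncrements φ F G b ε η) (h₀ : HasStieltjesIncrements φ F₀ G₀ b ε η)
    (ht : t ∈ Set.Icc 0 b) {m : ℕ} (hm : t / 2 ^ m ≤ η) :
    |G t - G₀ t| ≤ |G 0 - G₀ 0| + |dyadicStieltjesSum φ F t m - dyadicStieltjesSum φ F₀ t m| +
      ε * (F t - F 0) + ε * (F₀ t - F₀ 0) := by
  have hG := abs_le.1 (h.abs_sub_dyadicStieltjesSum_le ht hm)
  have hG₀ := abs_le.1 (h₀.abs_sub_dyadicStieltjesSum_le ht hm)
  have hstart := abs_le.1 (le_refl |G 0 - G₀ 0|)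
  have hsums := abs_le.1 (le_refl |dyadicStieltjesSum φ F t m - dyadicStieltjesSum φ F₀ t m|)
  rw [abs_le]
  constructor <;> linarith

theorem tendsto_of_hasStieltjesIncrements {ι : Type*} {l : Filter ι} {F G : ι → ℝ → ℝ}
    {F₀ G₀ : ℝ → ℝ} (hF : ∀ s ∈ Set.Icc 0 b, Tendsto (F · s) l (𝓝 (F₀ s)))
    (hG : Tendsto (G · 0) l (𝓝 (G₀ 0)))
    (hFG : ∀ ε > 0, ∃ η > 0, HasStieltjesIncrements φ F₀ G₀ b ε η ∧
      ∀ᶠ n in l, HasStieltjesIncrements φ (F n) (G n) b ε η) (ht : t ∈ Set.Icc 0 b) :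
    Tendsto (G · t) l (𝓝 (G₀ t)) := by
  rw [Metric.tendsto_nhds]
  intro δ hδ
  obtain ⟨ε, hε, hεδ⟩ : ∃ ε > 0, 2 * |F₀ t - F₀ 0| * ε < δ := exists_pos_mul_lt hδ _
  obtain ⟨η, hη, hFG₀, hFGn⟩ := hFG ε hε
  obtain ⟨m, hm⟩ := ((tendsto_dyadic_mesh t).eventually (ge_mem_nhds hη)).exists
  have hsums : Tendsto (fun n => dyadicStieltjesSum φ (F n) t m) l
      (𝓝 (dyadicStieltjesSum φ F₀ t m)) := by
    refine tendsto_finsetSum _ fun k hk => ((hF _ ?_).sub (hF _ ?_)).const_mul _ <;>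
    refine Set.Icc_subset_Icc_right ht.2 (dyadicPoint_mem_Icc ht.1 ?_)
    exacts [Finset.mem_range.1 hk, (Finset.mem_range.1 hk).le]
  have herror := (((hG.sub_const (G₀ 0)).abs.add
      (hsums.sub_const (dyadicStieltjesSum φ F₀ t m)).abs).add
    (((hF t ht).sub (hF 0 ⟨le_rfl, ht.1.trans ht.2⟩)).const_mul ε)).add_const (ε * (F₀ t - F₀ 0))
  have hsmall : ε * (F₀ t - F₀ 0) + ε * (F₀ t - F₀ 0) < δ :=
    lt_of_le_of_lt (by linarith [mul_le_mul_of_nonneg_left (le_abs_self (F₀ t - F₀ 0)) hε.le]) hεδ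
  simp only [sub_self, abs_zero, zero_add] at herror
  filter_upwards [hFGn, herror.eventually (gt_mem_nhds hsmall)] with n hn hlt
  exact (hn.abs_sub_le hFG₀ ht hm).trans_lt hlt

theorem hasStieltjesIncrements_integral (hφ : ContinuousOn φ (Set.Icc 0 b)) (hc : 0 ≤ c)
    (hmodulus : ∀ r ∈ Set.Icc 0 b, ∀ s ∈ Set.Icc 0 b, dist r s ≤ η → dist (φ r) (φ s) ≤ ε) :
    HasStieltjesIncrements φ (fun s => c * s) (fun s => c * ∫ r in (0 : ℝ)..s, φ r) b ε η := by
  intro s s' hs hss' hs' hη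
  have hintegrable {p q : ℝ} (hp : p ∈ Set.Icc 0 b) (hq : q ∈ Set.Icc 0 b) :
      IntervalIntegrable φ volume p q :=
    (hφ.mono (Set.uIcc_subset_Icc hp hq)).intervalIntegrable
  have hs₀ : (0 : ℝ) ∈ Set.Icc 0 b := ⟨le_rfl, hs.trans (hss'.trans hs')⟩
  have hsb : s ∈ Set.Icc 0 b := ⟨hs, hss'.trans hs'⟩
  have hsb' : s' ∈ Set.Icc 0 b := ⟨hs.trans hss', hs'⟩
  have hbound : |∫ r in s..s', (φ r - φ s)| ≤ ε * (s' - s) := by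
    rw [← Real.norm_eq_abs, ← abs_of_nonneg (sub_nonneg.2 hss')]
    refine intervalIntegral.norm_integral_le_of_norm_le_const fun r hr => ?_
    rw [Set.uIoc_of_le hss'] at hr
    refine hmodulus r ⟨hs.trans hr.1.le, hr.2.trans hs'⟩ s hsb ?_
    rw [Real.dist_eq, abs_of_pos (sub_pos.2 hr.1)]
    linarith [hr.2]
  calc |c * (∫ r in (0 : ℝ)..s', φ r) - c * (∫ r in (0 : ℝ)..s, φ r) - φ s * (c * s' - c * s)|
      = c * |∫ r in s..s', (φ r - φ s)| := by
        rw [intervalIntegral.integral_sub (hintegrable hsb hsb') (by simp),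
          ← intervalIntegral.integral_interval_sub_left (hintegrable hs₀ hsb')
            (hintegrable hs₀ hsb), intervalIntegral.integral_const, smul_eq_mul,
          ← abs_of_nonneg hc, ← abs_mul, abs_of_nonneg hc]
        congr 1
        ring
    _ ≤ c * (ε * (s' - s)) := by gcongr
    _ = ε * (c * s' - c * s) := by ring

theorem hasStieltjesIncrements_dyadic_sum {n : ℕ} {d u : ℕ → ℝ} (hT : 0 ≤ T) (hd : ∀ i, 0 ≤ d i)
    (hu : ∀ i < 2 ^ n, u i ∈ Set.Icc (dyadicPoint T n i) (dyadicPoint T n (i + 1)))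
    (hmodulus : ∀ r ∈ Set.Icc 0 T, ∀ s ∈ Set.Icc 0 T, dist r s ≤ η + T / 2 ^ n →
      dist (φ r) (φ s) ≤ ε) :
    HasStieltjesIncrements φ (fun s => ∑ i ∈ dyadicIndices T s n, d i)
      (fun s => ∑ i ∈ dyadicIndices T s n, φ (u i) * d i) T ε η := by
  intro s s' hs hss' hs' hη
  simp only [← Finset.sum_sdiff_eq_sub (dyadicIndices_subset hss' n)]
  rw [Finset.mul_sum, Finset.mul_sum, ← Finset.sum_sub_distrib]
  refine (Finset.abs_sum_le_sum_abs _ _).trans (Finset.sum_le_sum fun i hi => ?_)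
  rw [Finset.mem_sdiff, mem_dyadicIndices, mem_dyadicIndices] at hi
  obtain ⟨⟨hin, his'⟩, hnot⟩ := hi
  have his : s < dyadicPoint T n i := lt_of_not_ge fun hle => hnot ⟨hin, hle⟩
  have hlength := dyadicPoint_succ_sub T n i
  have hui := hu i hin
  have hdist : dist (u i) s ≤ η + T / 2 ^ n := by
    rw [Real.dist_eq, abs_of_nonneg (by linarith [hui.1])]
    linarith [hui.2]
  rw [← sub_mul, abs_mul, abs_of_nonneg (hd i)]
  exact mul_le_mul_of_nonneg_right
    (hmodulus _ (Icc_dyadicPoint_subset hT hin hui) s ⟨hs, hss'.trans hs'⟩ hdist) (hd i)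

theorem tendsto_dyadic_sum_mul {d u : ℕ → ℕ → ℝ} (hT : 0 < T)
    (hφ : ContinuousOn φ (Set.Icc 0 T)) (hd : ∀ n i, 0 ≤ d n i)
    (hu : ∀ n, ∀ i < 2 ^ n, u n i ∈ Set.Icc (dyadicPoint T n i) (dyadicPoint T n (i + 1)))
    (hF : ∀ s ∈ Set.Icc 0 T,
      Tendsto (fun n => ∑ i ∈ dyadicIndices T s n, d n i) atTop (𝓝 (c * s)))
    (ht : t ∈ Set.Icc 0 T) :
    Tendsto (fun n => ∑ i ∈ dyadicIndices T t n, φ (u n i) * d n i) atTop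
      (𝓝 (c * ∫ s in (0 : ℝ)..t, φ s)) := by
  have hc : 0 ≤ c := nonneg_of_mul_nonneg_left
    (ge_of_tendsto' (hF T ⟨hT.le, le_rfl⟩) fun n => Finset.sum_nonneg fun i _ => hd n i) hT
  refine tendsto_of_hasStieltjesIncrements (φ := φ) (F₀ := fun s => c * s)
    (G₀ := fun s => c * ∫ r in (0 : ℝ)..s, φ r)
    (G := fun n s => ∑ i ∈ dyadicIndices T s n, φ (u n i) * d n i) hF ?_ (fun ε hε => ?_) ht
  · obtain ⟨M, hM⟩ := isCompact_Icc.exists_bound_of_continuousOn hφ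
    have hbound := (hF 0 ⟨le_rfl, hT.le⟩).const_mul M
    rw [mul_zero, mul_zero] at hbound
    rw [intervalIntegral.integral_same, mul_zero]
    refine squeeze_zero_norm (fun n => ?_) hbound
    rw [Finset.mul_sum]
    refine norm_sum_le_of_le _ fun i hi => ?_
    have hin := (mem_dyadicIndices.1 hi).1
    rw [norm_mul, Real.norm_of_nonneg (hd n i)]
    exact mul_le_mul_of_nonneg_right (hM _ (Icc_dyadicPoint_subset hT.le hin (hu n i hin)))
      (hd n i)
  · obtain ⟨η, hη, hmodulus⟩ := Metric.uniformContinuousOn_iff_le.1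
      (isCompact_Icc.uniformContinuousOn_of_continuous hφ) ε hε
    refine ⟨η / 2, half_pos hη, hasStieltjesIncrements_integral hφ hc fun r hr s hs h =>
      hmodulus r hr s hs (h.trans (half_le_self hη.le)), ?_⟩
    filter_upwards [(tendsto_dyadic_mesh T).eventually (ge_mem_nhds (half_pos hη))] with n hmesh
    exact hasStieltjesIncrements_dyadic_sum hT.le (hd n) (hu n) fun r hr s hs h =>
      hmodulus r hr s hs (by linarith)

theorem tendsto_dyadicQVSum_comp {x f f' : ℝ → ℝ} (hT : 0 < T)
    (hf : ∀ z, HasDerivAt f (f' z) z) (hf' : Continuous f') (hx : ContinuousOn x (Set.Icc 0 T))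
    (hV : ∀ s ∈ Set.Icc 0 T, Tendsto (dyadicQVSum T x s) atTop (𝓝 (c * s)))
    (ht : t ∈ Set.Icc 0 T) :
    Tendsto (dyadicQVSum T (fun s => f (x s)) t) atTop
      (𝓝 (∫ s in (0 : ℝ)..t, c * f' (x s) ^ 2)) := by
  choose! u hu hincrement using fun (n i : ℕ) (hi : i < 2 ^ n) =>
    exists_dyadicIncrement_comp_eq_deriv_mul hT.le hf hx hi
  rw [intervalIntegral.integral_const_mul]
  refine (tendsto_dyadic_sum_mul (d := fun n i => dyadicIncrement T x n i ^ 2) (u := u) hT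
    ((hf'.comp_continuousOn hx).pow 2) (fun n i => sq_nonneg _) hu ?_ ht).congr fun n => ?_
  · simpa only [← dyadicQVSum_eq_sum] using hV
  · rw [dyadicQVSum_eq_sum]
    refine Finset.sum_congr rfl fun i hi => ?_
    rw [hincrement n i (mem_dyadicIndices.1 hi).1, mul_pow]
    rfl

end StieltjesSums

section FractionalExponentialModels

variable {Ω : Type*} [MeasurableSpace Ω] {P : Measure Ω} {T H s₀ μ σ ν : ℝ} {S : ℝ → Ω → ℝ}

/-- The common form of the three price models: `W` and `B` need not be independent, and `σ` and
`ν` may vanish, in which case nothing is required of `W`, respectively `B`. -/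
def IsFractionalExpModel (P : Measure Ω) (T H s₀ μ σ ν : ℝ) (S : ℝ → Ω → ℝ) : Prop :=
  ∃ W B : ℝ → Ω → ℝ, (σ ≠ 0 → IsBM P T W) ∧ (ν ≠ 0 → IsFBM P T H B) ∧
    ∀ᵐ ω ∂P, ∀ t ∈ Set.Icc (0 : ℝ) T,
      S t ω = s₀ * Real.exp (μ * t + σ * W t ω - 1 / 2 * σ ^ 2 * t + ν * B t ω)

theorem IsBSModel.isFractionalExpModel (h : IsBSModel P T s₀ μ σ S) (H : ℝ) :
    IsFractionalExpModel P T H s₀ μ σ 0 S := by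
  obtain ⟨-, -, W, hW, hS⟩ := h
  exact ⟨W, W, fun _ => hW, fun h₀ => absurd rfl h₀, by simpa using hS⟩

theorem IsFBSModel.isFractionalExpModel (h : IsFBSModel P T H s₀ μ ν S) :
    IsFractionalExpModel P T H s₀ μ 0 ν S := by
  obtain ⟨-, -, -, B, hB, hS⟩ := h
  exact ⟨B, B, fun h₀ => absurd rfl h₀, fun _ => hB, by simpa using hS⟩

theorem IsMFBSModel.isFractionalExpModel (h : IsMFBSModel P T H s₀ μ σ ν S) :
    IsFractionalExpModel P T H s₀ μ σ ν S := by
  obtain ⟨-, -, -, -, W, B, hW, hB, -, hS⟩ := h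
  exact ⟨W, B, fun _ => hW, fun _ => hB, hS⟩

theorem ae_continuousOn_const_mul {c : ℝ} {X : ℝ → Ω → ℝ} (hX : c ≠ 0 → IsFBM P T H X) :
    ∀ᵐ ω ∂P, ContinuousOn (fun s => c * X s ω) (Set.Icc 0 T) := by
  obtain rfl | hc := eq_or_ne c 0
  · simp [continuousOn_const]
  · filter_upwards [(hX hc).continuous_paths] with ω hω using hω.const_mul c

theorem ae_tendsto_dyadicQVSum_const_mul_of_isBM {W : ℝ → Ω → ℝ} (hT : 0 < T)
    (hW : σ ≠ 0 → IsBM P T W) : ∀ᵐ ω ∂P, ∀ t ∈ Set.Icc 0 T,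
      Tendsto (dyadicQVSum T (fun s => σ * W s ω) t) atTop (𝓝 (σ ^ 2 * t)) := by
  obtain rfl | hσ := eq_or_ne σ 0
  · refine ae_of_all _ fun ω t ht => ?_
    simpa using tendsto_dyadicQVSum_linear hT ht 0
  · filter_upwards [(hW hσ).ae_tendsto_dyadicQVSum hT] with ω hω t ht
    exact tendsto_dyadicQVSum_const_mul (hω t ht) σ

theorem ae_tendsto_dyadicQVSum_const_mul_of_isFBM {B : ℝ → Ω → ℝ} (hT : 0 < T)
    (hB : ν ≠ 0 → IsFBM P T H B) (hν : ν = 0 ∨ 1 / 2 < H) : ∀ᵐ ω ∂P, ∀ t ∈ Set.Icc 0 T,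
      Tendsto (dyadicQVSum T (fun s => ν * B s ω) t) atTop (𝓝 0) := by
  obtain rfl | hν₀ := eq_or_ne ν 0
  · refine ae_of_all _ fun ω t ht => ?_
    simpa using tendsto_dyadicQVSum_linear hT ht 0
  · filter_upwards [(hB hν₀).ae_tendsto_dyadicQVSum_zero (hν.resolve_left hν₀) hT] with ω hω t ht
    simpa using tendsto_dyadicQVSum_const_mul (hω t ht) ν

theorem IsFractionalExpModel.ae_exists_log_price (h : IsFractionalExpModel P T H s₀ μ σ ν S)
    (hT : 0 < T) : ∀ᵐ ω ∂P, ∃ x : ℝ → ℝ, ContinuousOn x (Set.Icc 0 T) ∧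
      Set.EqOn (S · ω) (fun s => s₀ * Real.exp (x s)) (Set.Icc 0 T) ∧
      (ν ≠ 0 → H < 1 / 2 → ∀ t ∈ Set.Ioc 0 T, Tendsto (dyadicQVSum T x t) atTop atTop) ∧
      (ν = 0 ∨ 1 / 2 < H → ∀ t ∈ Set.Icc 0 T,
        Tendsto (dyadicQVSum T x t) atTop (𝓝 (σ ^ 2 * t))) := by
  obtain ⟨W, B, hW, hB, hS⟩ := h
  have hdiverges : ∀ᵐ ω ∂P, ν ≠ 0 → H < 1 / 2 → ∀ t ∈ Set.Ioc 0 T,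
      Tendsto (dyadicQVSum T (B · ω) t) atTop atTop := by
    simp only [eventually_imp_distrib_left]
    exact fun hν hH => (hB hν).ae_tendsto_dyadicQVSum_atTop hH hT
  have hvanishes : ∀ᵐ ω ∂P, ν = 0 ∨ 1 / 2 < H → ∀ t ∈ Set.Icc 0 T,
      Tendsto (dyadicQVSum T (fun s => ν * B s ω) t) atTop (𝓝 0) :=
    eventually_imp_distrib_left.2 (ae_tendsto_dyadicQVSum_const_mul_of_isFBM hT hB)
  filter_upwards [hS, ae_continuousOn_const_mul hW, ae_continuousOn_const_mul hB,
    ae_tendsto_dyadicQVSum_const_mul_of_isBM hT hW, hdiverges, hvanishes]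
    with ω hSω hWc hBc hWV hBtop hBzero
  have hsemimartingale (t : ℝ) (ht : t ∈ Set.Icc 0 T) := tendsto_dyadicQVSum_add (hWV t ht)
    (tendsto_dyadicQVSum_linear hT ht (μ - 1 / 2 * σ ^ 2))
  refine ⟨fun s => σ * W s ω + (μ - 1 / 2 * σ ^ 2) * s + ν * B s ω,
    (hWc.add (continuous_const_mul _).continuousOn).add hBc, fun s hs => ?_,
    fun hν hH t ht => tendsto_dyadicQVSum_add_atTop
      (hsemimartingale t (Set.Ioc_subset_Icc_self ht))
      (tendsto_dyadicQVSum_const_mul_atTop hν (hBtop hν hH t ht)),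
    fun hν t ht => tendsto_dyadicQVSum_add (hsemimartingale t ht) (hBzero hν t ht)⟩
  refine (hSω s hs).trans ?_
  ring_nf

theorem IsFractionalExpModel.dyadicQVDiverges (h : IsFractionalExpModel P T H s₀ μ σ ν S)
    (hT : 0 < T) (hs₀ : s₀ ≠ 0) (hν : ν ≠ 0) (hH : H < 1 / 2) : DyadicQVDiverges P T S := by
  filter_upwards [h.ae_exists_log_price hT] with ω ⟨x, hx, hSx, hV, _⟩ t ht
  rw [dyadicQVSum_congr hT.le hSx]
  exact tendsto_dyadicQVSum_comp_atTop hT.le (fun z => (Real.hasDerivAt_exp z).const_mul s₀)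
    (Real.continuous_exp.const_mul s₀) (fun z => mul_ne_zero hs₀ (Real.exp_ne_zero z)) hx
    (hV hν hH t ht)

theorem IsFractionalExpModel.hasDyadicQV (h : IsFractionalExpModel P T H s₀ μ σ ν S)
    (hT : 0 < T) (hν : ν = 0 ∨ 1 / 2 < H) :
    HasDyadicQV P T S fun t ω => ∫ u in (0 : ℝ)..t, σ ^ 2 * S u ω ^ 2 := by
  filter_upwards [h.ae_exists_log_price hT] with ω ⟨x, hx, hSx, _, hV⟩ t ht
  have hQV := tendsto_dyadicQVSum_comp (f := fun z => s₀ * Real.exp z) hT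
    (fun z => (Real.hasDerivAt_exp z).const_mul s₀) (Real.continuous_exp.const_mul s₀) hx (hV hν) ht
  have hintegrand : Set.EqOn (fun u => σ ^ 2 * S u ω ^ 2)
      (fun u => σ ^ 2 * (s₀ * Real.exp (x u)) ^ 2) (Set.uIcc 0 t) := by
    intro u hu
    have hSu : S u ω = s₀ * Real.exp (x u) := hSx (Set.uIcc_subset_Icc ⟨le_rfl, hT.le⟩ ht hu)
    simp only [hSu]
  rwa [dyadicQVSum_congr hT.le hSx, intervalIntegral.integral_congr hintegrand]

theorem mainTheorem8_general (h : IsFractionalExpModel P T H s₀ μ σ ν S) (hT : 0 < T) :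
    (s₀ ≠ 0 → ν ≠ 0 → H < 1 / 2 → DyadicQVDiverges P T S) ∧
    (ν = 0 ∨ 1 / 2 < H →
      HasDyadicQV P T S fun t ω => ∫ u in (0 : ℝ)..t, σ ^ 2 * S u ω ^ 2) :=
  ⟨h.dyadicQVDiverges hT, h.hasDyadicQV hT⟩

end FractionalExponentialModels

end FractionalPricing

theorem mainTheorem8 {Ω : Type*} [MeasurableSpace Ω] (P : Measure Ω) [IsProbabilityMeasure P]
    (T : ℝ) (hT : 0 < T) (H s₀ μ σ ν : ℝ) (S : ℝ → Ω → ℝ) :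
    (H < 1 / 2 → IsFBSModel P T H s₀ μ ν S → DyadicQVDiverges P T S) ∧
    (H < 1 / 2 → IsMFBSModel P T H s₀ μ σ ν S → DyadicQVDiverges P T S) ∧
    (1 / 2 < H → IsFBSModel P T H s₀ μ ν S → HasDyadicQV P T S (fun _ _ => 0)) ∧
    (IsBSModel P T s₀ μ σ S →
      HasDyadicQV P T S (fun t ω => ∫ u in (0 : ℝ)..t, σ ^ 2 * S u ω ^ 2)) ∧
    (1 / 2 < H → IsMFBSModel P T H s₀ μ σ ν S →
      HasDyadicQV P T S (fun t ω => ∫ u in (0 : ℝ)..t, σ ^ 2 * S u ω ^ 2)) := by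
  refine ⟨fun hH h => ?_, fun hH h => ?_, fun hH h => ?_, fun h => ?_, fun hH h => ?_⟩
  · exact (mainTheorem8_general h.isFractionalExpModel hT).1 h.2.1.ne' h.2.2.1.ne' hH
  · exact (mainTheorem8_general h.isFractionalExpModel hT).1 h.2.1.ne' h.2.2.2.1.ne' hH
  · simpa using (mainTheorem8_general h.isFractionalExpModel hT).2 (.inr hH)
  · exact (mainTheorem8_general (h.isFractionalExpModel H) hT).2 (.inl rfl)
  · exact (mainTheorem8_general h.isFractionalExpModel hT).2 (.inr hH)
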